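/- Let $d\ge 1$, let $\mathbb R^d$ carry its standard scalar product $\langle\cdot,\cdot\rangle$, and let $|||\cdot|||$ be any norm on $\mathbb R^d$ (not necessarily Euclidean). For a norm $N$ write $N_\star(y)=\sup_{N(x)\le 1}\langle x,y\rangle$ for its dual norm. For $K\subset\{1,\dots,d\}$ let $\mathcal R_K=\{x\in\mathbb R^d : x_j=0\ \forall j\notin K\}$, let $y_K$ be the orthogonal projection of $y$ onto $\mathcal R_K$, and let $|||\cdot|||_{K,\star}$ be the dual norm, on $\mathcal R_K$, of the restriction of $|||\cdot|||$ to $\mathcal R_K$. For $l\in\{1,\dots,d\}$ define the dual coordinate-$l$ norm $$\|y\|_{(l)}^{\star}=\sup_{K\subset\{1,\dots,d\},\,|K|\le l}|||y_K|||_{K,\star},\qquad y\in\mathbb R^d,$$ with unit ball $B_{(l)}^\star=\{y:\|y\|_{(l)}^\star\le 1\}$, and let the coordinate-$l$ norm $\|\cdot\|_{(l)}$ be the norm whose dual norm is $\|\cdot\|_{(l)}^\star$, that is, $\|x\|_{(l)}=\sup_{\|y\|_{(l)}^\star\le 1}\langle x,y\rangle$. (This formula does define a norm with that dual norm; this is part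 of the assertion.) Let $\ell_0(x)$ be the number of nonzero components of $x$. Let $\varphi:\{0,1,\dots,d\}\to[0,+\infty)$ satisfy $\varphi(0)=0$ and $\varphi(l)>0$ for all $l\in\{1,\dots,d\}$. Then there exists a norm $\|\cdot\|_\varphi$ on $\mathbb R^d$ with the following properties. 1. Its dual norm $\|\cdot\|_\varphi^\star$ has unit ball $B_\varphi^\star=\bigcap_{l=1}^d \varphi(l)B_{(l)}^\star$, and $\|x\|_\varphi=\sup_{y\in B_\varphi^\star}\langle y,x\rangle$ for all $x$; equivalently, $$\|y\|_\varphi^\star=\sup_{1\le l\le d}\frac{\|y\|_{(l)}^\star}{\varphi(l)}\qquad\text{for all }y\in\mathbb R^d.$$ Each of these two descriptions of the dual norm characterizes $\|\cdot\|_\varphi$ uniquely among the norms on $\mathbb R^d$. 2. It is the inf-convolution of the norms $\varphi(l)\|\cdot\|_{(l)}$: for all $x\in\mathbb R^d$, $$\|x\|_\varphi=\inf\Big\{\sum_{l=1}^d\varphi(l)\,\|z^{(l)}\|_{(l)} \;:\; z^{(1)},\dots,z^{(d)}\in\mathbb R^d,\ \sum_{l=1}^d z^{(l)}=x\Big\}.$$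 3. For all $x\in\mathbb R^d\setminus\{0\}$, $$\frac{\|x\|_\varphi}{|||x|||}\ \le\ \frac1{|||x|||}\min\Big\{\sum_{l=1}^d\varphi(l)\,\|z^{(l)}\|_{(l)} : z^{(1)},\dots,z^{(d)}\in\mathbb R^d,\ \sum_{l=1}^d\|z^{(l)}\|_{(l)}\le|||x|||,\ \sum_{l=1}^d z^{(l)}=x\Big\}\ \le\ \varphi(\ell_0(x)),$$ where the minimum is attained. -/

import Mathlib

open scoped Pointwise

/-- `N` is a norm on the real vector space `F`. -/
structure IsNorm {F : Type*} [AddCommGroup F] [Module ℝ F] (N : F → ℝ) : Prop where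
  nonneg : ∀ x, 0 ≤ N x
  eq_zero_iff : ∀ x, N x = 0 ↔ x = 0
  smul : ∀ (r : ℝ) (x : F), N (r • x) = |r| * N x
  add_le : ∀ x y, N (x + y) ≤ N x + N y

/-- The closed unit ball of `N`. -/
def normUnitBall {F : Type*} (N : F → ℝ) : Set F := {x | N x ≤ 1}

/-- The dual norm `y ↦ sup {⟨x, y⟩ | N x ≤ 1}` with respect to the inner product of `F`. -/
noncomputable def dualNorm {F : Type*} [NormedAddCommGroup F] [InnerProductSpace ℝ F]
    (N : F → ℝ) (y : F) : ℝ :=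
  sSup ((fun x : F => inner ℝ x y) '' normUnitBall N)

/-- The pseudonorm `ℓ₀`: the number of nonzero components of `x`, an element of `{0, …, d}`. -/
noncomputable def lzero {d : ℕ} (x : EuclideanSpace ℝ (Fin d)) : Fin (d + 1) :=
  ⟨(Finset.univ.filter fun j => x j ≠ 0).card,
    Nat.lt_succ_of_le (by simpa using Finset.card_le_univ (Finset.univ.filter fun j => x j ≠ 0))⟩

/-- The subspace of the vectors whose components vanish outside of `K`. -/
def flatSubspace {d : ℕ} (K : Finset (Fin d)) : Submodule ℝ (EuclideanSpace ℝ (Fin d)) where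
  carrier := {x | ∀ j, j ∉ K → x j = 0}
  zero_mem' := by intro j _; simp
  add_mem' := by
    intro x y hx hy j hj
    simp [hx j hj, hy j hj]
  smul_mem' := by
    intro r x hx j hj
    simp [hx j hj]

/-- The orthogonal projection of `y` onto `flatSubspace K`: it keeps the components in `K` and
replaces the others by zero. -/
noncomputable def flatProj {d : ℕ} (K : Finset (Fin d)) (y : EuclideanSpace ℝ (Fin d)) :
    flatSubspace K :=
  ⟨WithLp.toLp 2 (fun j => if j ∈ K then y j else 0), by
    intro j hj
    simp [hj]⟩

/-- The restriction of `N` to `flatSubspace K`. -/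
def restrictionNorm {d : ℕ} (N : EuclideanSpace ℝ (Fin d) → ℝ) (K : Finset (Fin d)) :
    flatSubspace K → ℝ :=
  fun x => N x

/-- The dual coordinate-`k` norm: the supremum over all `K` with at most `k` elements of the dual
norm, on the subspace `flatSubspace K`, of the restriction of `N`, evaluated at the projection. -/
noncomputable def dualCoordNorm {d : ℕ} (N : EuclideanSpace ℝ (Fin d) → ℝ) (k : ℕ)
    (y : EuclideanSpace ℝ (Fin d)) : ℝ :=
  ⨆ K : {K : Finset (Fin d) // K.card ≤ k},
    dualNorm (restrictionNorm N K.1) (flatProj K.1 y)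

/-- The coordinate-`k` norm: the norm whose dual norm is the dual coordinate-`k` norm. By
biduality it is obtained by dualizing the latter once more. -/
noncomputable def coordNorm {d : ℕ} (N : EuclideanSpace ℝ (Fin d) → ℝ) (k : ℕ) :
    EuclideanSpace ℝ (Fin d) → ℝ :=
  dualNorm (dualCoordNorm N k)

/-!
Everything rests on finite-dimensional duality for norms given as bare functions `N : F → ℝ` on a
Euclidean space. Such an `N` is continuous (it is convex) and bounded below by a multiple of the
Euclidean norm (compactness of the sphere), so `dualNorm N` is a supremum of a bounded set and is
again a norm. The Hahn–Banach theorem in the form `exists_inner_le_of_sublinear` (a sublinear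
function is, at each point, the value of an inner product which it dominates) gives biduality
`dualNorm (dualNorm N) = N`, hence a norm is determined by its dual unit ball.

The dual coordinate norms are suprema of finitely many seminorms, and those attached to the
singletons `K` separate points, so they are norms, and biduality says that `coordNorm N k` is the norm
having `dualCoordNorm N k` as its dual. The required norm is the dual of the norm
`M y = sup_l dualCoordNorm N l y / φ l`; its dual is `M`, again by biduality.

For the inf-convolution formula, the inf-convolution of norms is sublinear, so at each point it is
attained by some `⟨·, y⟩` below it; such a `y` is below each `φ l * coordNorm N l`, that is, `y` lies
in the unit ball of `M`. This is `isGLB_infConvolution_dualNorm`.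

The constrained minimum exists by compactness. It is at most `φ (ℓ₀ x) * N x`, because the
decomposition having `x` itself as its only nonzero term, at `l = ℓ₀ x`, is admissible:
`coordNorm N (ℓ₀ x) x ≤ N x`, since `⟨x, y⟩` depends only on the projection of `y` onto the
coordinates in the support of `x`.
-/

/-! ### Norms on a Euclidean space and their duals -/

section Duality

variable {F : Type*} [NormedAddCommGroup F] [InnerProductSpace ℝ F]

theorem IsNorm.map_zero {N : F → ℝ} (hN : IsNorm N) : N 0 = 0 :=
  (hN.eq_zero_iff 0).2 rfl

theorem IsNorm.pos {N : F → ℝ} (hN : IsNorm N) {x : F} (hx : x ≠ 0) : 0 < N x :=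
  lt_of_le_of_ne (hN.nonneg x) fun h => hx ((hN.eq_zero_iff x).1 h.symm)

theorem IsNorm.convexOn {N : F → ℝ} (hN : IsNorm N) : ConvexOn ℝ Set.univ N := by
  refine ⟨convex_univ, fun x _ y _ a b ha hb _ => (hN.add_le _ _).trans ?_⟩
  simp [hN.smul, abs_of_nonneg ha, abs_of_nonneg hb]

theorem IsNorm.continuous [FiniteDimensional ℝ F] {N : F → ℝ} (hN : IsNorm N) : Continuous N :=
  hN.convexOn.locallyLipschitz.continuous

theorem IsNorm.exists_mul_norm_le [FiniteDimensional ℝ F] {N : F → ℝ} (hN : IsNorm N) :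
    ∃ c > 0, ∀ x, c * ‖x‖ ≤ N x := by
  rcases (Metric.sphere (0 : F) 1).eq_empty_or_nonempty with hS | hS
  · refine ⟨1, one_pos, fun x => ?_⟩
    by_cases hx : x = 0
    · simp [hx, hN.map_zero]
    · have : ‖x‖⁻¹ • x ∈ Metric.sphere (0 : F) 1 := by simp [norm_smul, hx]
      simp [hS] at this
  · obtain ⟨u, hu, hmin⟩ := (isCompact_sphere (0 : F) 1).exists_isMinOn hS hN.continuous.continuousOn
    refine ⟨N u, hN.pos (by rintro rfl; simp at hu), fun x => ?_⟩
    by_cases hx : x = 0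
    · simp [hx, hN.map_zero]
    · have hx' : 0 < ‖x‖ := norm_pos_iff.2 hx
      have h : N u ≤ N (‖x‖⁻¹ • x) := hmin (by simp [norm_smul, hx])
      rw [hN.smul, abs_of_pos (inv_pos.2 hx')] at h
      rwa [inv_mul_eq_div, le_div_iff₀ hx'] at h

theorem IsNorm.zero_mem_normUnitBall {N : F → ℝ} (hN : IsNorm N) : (0 : F) ∈ normUnitBall N := by
  simp [normUnitBall, hN.map_zero]

/-- The supremum defining the dual norm is a genuine one. -/
theorem IsNorm.isLUB_dualNorm [FiniteDimensional ℝ F] {N : F → ℝ} (hN : IsNorm N) (y : F) :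
    IsLUB ((fun x : F => inner ℝ x y) '' normUnitBall N) (dualNorm N y) := by
  obtain ⟨c, hc, h⟩ := hN.exists_mul_norm_le
  refine isLUB_csSup (Set.Nonempty.image _ ⟨0, hN.zero_mem_normUnitBall⟩) ⟨c⁻¹ * ‖y‖, ?_⟩
  rintro _ ⟨x, hx, rfl⟩
  refine (real_inner_le_norm x y).trans (mul_le_mul_of_nonneg_right ?_ (norm_nonneg y))
  rw [← one_div, le_div_iff₀' hc]
  exact (h x).trans hx

theorem IsNorm.inner_le_mul_dualNorm [FiniteDimensional ℝ F] {N : F → ℝ} (hN : IsNorm N)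
    (x y : F) : inner ℝ x y ≤ N x * dualNorm N y := by
  by_cases hx : x = 0
  · simp [hx, hN.map_zero]
  · have hx' := hN.pos hx
    have h := (hN.isLUB_dualNorm y).1 ⟨(N x)⁻¹ • x,
      by simp [normUnitBall, hN.smul, abs_of_pos hx', hx'.ne'], rfl⟩
    simp only [real_inner_smul_left] at h
    rwa [inv_mul_eq_div, div_le_iff₀' hx'] at h

theorem IsNorm.dualNorm_le_iff [FiniteDimensional ℝ F] {N : F → ℝ} (hN : IsNorm N) {y : F} {r : ℝ}
    (hr : 0 ≤ r) : dualNorm N y ≤ r ↔ ∀ x, inner ℝ x y ≤ r * N x := by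
  refine ⟨fun h x => (hN.inner_le_mul_dualNorm x y).trans ?_, fun h => ?_⟩
  · rw [mul_comm]
    exact mul_le_mul_of_nonneg_right h (hN.nonneg x)
  · refine (hN.isLUB_dualNorm y).2 ?_
    rintro _ ⟨x, hx, rfl⟩
    exact (h x).trans (mul_le_of_le_one_right hr hx)

theorem IsNorm.dualNorm_nonneg [FiniteDimensional ℝ F] {N : F → ℝ} (hN : IsNorm N) (y : F) :
    0 ≤ dualNorm N y :=
  (hN.isLUB_dualNorm y).1 ⟨0, hN.zero_mem_normUnitBall, by simp⟩

theorem IsNorm.isNorm_dualNorm [FiniteDimensional ℝ F] {N : F → ℝ} (hN : IsNorm N) :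
    IsNorm (dualNorm N) where
  nonneg := hN.dualNorm_nonneg
  eq_zero_iff y := by
    constructor
    · intro h
      have := hN.inner_le_mul_dualNorm y y
      rw [h, mul_zero] at this
      exact real_inner_self_nonpos.1 this
    · rintro rfl
      exact le_antisymm ((hN.dualNorm_le_iff le_rfl).2 (by simp)) (hN.dualNorm_nonneg 0)
  smul r y := by
    have key : ∀ (s : ℝ) (z : F), dualNorm N (s • z) ≤ |s| * dualNorm N z := by
      intro s z
      refine (hN.dualNorm_le_iff (mul_nonneg (abs_nonneg s) (hN.dualNorm_nonneg z))).2 fun x => ?_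
      have h := hN.inner_le_mul_dualNorm (s • x) z
      rw [hN.smul, real_inner_smul_left] at h
      rw [real_inner_smul_right]
      linarith
    refine le_antisymm (key r y) ?_
    by_cases hr : r = 0
    · simpa [hr] using hN.dualNorm_nonneg 0
    · have h := key r⁻¹ (r • y)
      rwa [smul_smul, inv_mul_cancel₀ hr, one_smul, abs_inv, inv_mul_eq_div,
        le_div_iff₀' (abs_pos.2 hr)] at h
  add_le y z := by
    refine (hN.dualNorm_le_iff (add_nonneg (hN.dualNorm_nonneg y) (hN.dualNorm_nonneg z))).2
      fun x => ?_
    rw [inner_add_right]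
    linarith [hN.inner_le_mul_dualNorm x y, hN.inner_le_mul_dualNorm x z]

/-- The Hahn–Banach theorem for a sublinear function `p`, with the linear functional represented by
a vector: `p` has a subgradient `y` at `x`. -/
theorem exists_inner_le_of_sublinear [FiniteDimensional ℝ F] {p : F → ℝ}
    (hsmul : ∀ c : ℝ, 0 < c → ∀ x, p (c • x) = c * p x) (hadd : ∀ x y, p (x + y) ≤ p x + p y)
    (x : F) : ∃ y : F, (∀ z, inner ℝ z y ≤ p z) ∧ inner ℝ x y = p x := by
  have h0 : p 0 = 0 := by
    have := hsmul 2 two_pos 0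
    rw [smul_zero] at this
    linarith
  have H : ∀ c : ℝ, c • x = 0 → c • p x = 0 := by
    intro c hc
    rcases smul_eq_zero.1 hc with rfl | rfl <;> simp [h0]
  obtain ⟨g, hg, hgp⟩ := exists_extension_of_le_sublinear
    (LinearPMap.mkSpanSingleton' (σ := RingHom.id ℝ) x (p x) H) p hsmul hadd (by
      rintro ⟨z, hz⟩
      obtain ⟨c, rfl⟩ := Submodule.mem_span_singleton.1 hz
      rw [LinearPMap.mkSpanSingleton'_apply]
      simp only [RingHom.id_apply, smul_eq_mul]
      -- for `c < 0` the bound comes from `0 = p 0 ≤ p (c • x) + p (-c • x)`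
      rcases lt_trichotomy c 0 with hc | rfl | hc
      · have h1 := hadd (c • x) ((-c) • x)
        rw [← add_smul, add_neg_cancel, zero_smul, h0, hsmul (-c) (neg_pos.2 hc)] at h1
        linarith
      · simp [h0]
      · exact (hsmul c hc x).ge)
  have hgy : ∀ z, inner ℝ z ((InnerProductSpace.toDual ℝ F).symm g.toContinuousLinearMap) = g z := by
    intro z
    rw [real_inner_comm, InnerProductSpace.toDual_symm_apply]
    rfl
  refine ⟨_, fun z => (hgy z).trans_le (hgp z), (hgy x).trans ?_⟩
  exact (hg ⟨x, Submodule.mem_span_singleton_self x⟩).trans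
    (LinearPMap.mkSpanSingleton'_apply_self _ _ _ _)

theorem IsNorm.dualNorm_dualNorm [FiniteDimensional ℝ F] {N : F → ℝ} (hN : IsNorm N) :
    dualNorm (dualNorm N) = N := by
  funext x
  refine le_antisymm ?_ ?_
  · refine (hN.isNorm_dualNorm.dualNorm_le_iff (hN.nonneg x)).2 fun y => ?_
    rw [real_inner_comm]
    exact hN.inner_le_mul_dualNorm x y
  · obtain ⟨y, hy, hyx⟩ := exists_inner_le_of_sublinear
      (fun c hc x => by rw [hN.smul, abs_of_pos hc]) hN.add_le x
    have hy1 : dualNorm N y ≤ 1 := (hN.dualNorm_le_iff zero_le_one).2 (by simpa using hy)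
    have h := (hN.isNorm_dualNorm.isLUB_dualNorm x).1 ⟨y, hy1, rfl⟩
    simp only [real_inner_comm x y] at h
    exact hyx.symm.trans_le (by simpa [real_inner_comm] using h)

/-- A norm is determined by the unit ball of its dual norm. -/
theorem IsNorm.eq_of_normUnitBall_dualNorm_eq [FiniteDimensional ℝ F] {N₁ N₂ : F → ℝ}
    (h₁ : IsNorm N₁) (h₂ : IsNorm N₂)
    (h : normUnitBall (dualNorm N₁) = normUnitBall (dualNorm N₂)) : N₁ = N₂ := by
  rw [← h₁.dualNorm_dualNorm, ← h₂.dualNorm_dualNorm]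
  funext x
  rw [dualNorm, h, dualNorm]

theorem IsNorm.smul_normUnitBall {N : F → ℝ} (hN : IsNorm N) {r : ℝ} (hr : 0 < r) :
    r • normUnitBall N = {x | N x ≤ r} := by
  ext x
  rw [Set.mem_smul_set_iff_inv_smul_mem₀ hr.ne']
  simp only [normUnitBall, Set.mem_ofPred_eq]
  rw [hN.smul, abs_of_pos (inv_pos.2 hr), inv_mul_eq_div, div_le_one hr]

end Duality

/-! ### Suprema and inf-convolutions of norms -/

section Families

open Finset

/-- A supremum of finitely many seminorms which together separate points is a norm. -/
theorem isNorm_iSup {F : Type*} [AddCommGroup F] [Module ℝ F] {ι : Type*} [Finite ι] [Nonempty ι]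
    {P : ι → F → ℝ} (hnonneg : ∀ i x, 0 ≤ P i x)
    (hsmul : ∀ i (r : ℝ) x, P i (r • x) = |r| * P i x)
    (hadd : ∀ i x y, P i (x + y) ≤ P i x + P i y) (hsep : ∀ x, (∀ i, P i x = 0) → x = 0) :
    IsNorm fun x => ⨆ i, P i x where
  nonneg x := Real.iSup_nonneg fun i => hnonneg i x
  eq_zero_iff x := by
    refine ⟨fun h => hsep x fun i => le_antisymm ?_ (hnonneg i x), ?_⟩
    · exact (le_ciSup (Set.finite_range fun i => P i x).bddAbove i).trans h.le
    · rintro rfl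
      have : ∀ i, P i 0 = 0 := fun i => by simpa using hsmul i 0 0
      simp [this]
  smul r x := by
    simp only [hsmul]
    rw [Real.mul_iSup_of_nonneg (abs_nonneg r)]
  add_le x y := ciSup_le fun i => (hadd i x y).trans <|
    add_le_add (le_ciSup (Set.finite_range fun i => P i x).bddAbove i)
      (le_ciSup (Set.finite_range fun i => P i y).bddAbove i)

variable {F : Type*} [NormedAddCommGroup F] [InnerProductSpace ℝ F] {ι : Type*} [Fintype ι]

/-- If the unit ball of the norm `M` consists of the `y` with `⟨·, y⟩ ≤ P i` for all `i`, then the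
dual norm of `M` is the inf-convolution of the norms `P i`. -/
theorem isGLB_infConvolution_dualNorm [FiniteDimensional ℝ F] [Nonempty ι] {P : ι → F → ℝ}
    (hP : ∀ i, IsNorm (P i)) {M : F → ℝ} (hM : IsNorm M)
    (hball : ∀ y, M y ≤ 1 ↔ ∀ i z, inner ℝ z y ≤ P i z) (x : F) :
    IsGLB {s : ℝ | ∃ z : ι → F, ∑ i, z i = x ∧ s = ∑ i, P i (z i)} (dualNorm M x) := by
  classical
  set S : F → Set ℝ := fun x => {s : ℝ | ∃ z : ι → F, ∑ i, z i = x ∧ s = ∑ i, P i (z i)}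
  have hsingle : ∀ i x, P i x ∈ S x := by
    intro i x
    refine ⟨Pi.single i x, by simp, ?_⟩
    rw [Finset.sum_eq_single i (fun j _ hj => by simp [hj, (hP j).map_zero]) (by simp)]
    simp
  have hne : ∀ x, (S x).Nonempty := fun x => ⟨_, hsingle (Classical.arbitrary ι) x⟩
  have hbdd : ∀ x, BddBelow (S x) := by
    refine fun x => ⟨0, ?_⟩
    rintro _ ⟨z, -, rfl⟩
    exact sum_nonneg fun i _ => (hP i).nonneg _
  have hsmul_le : ∀ c : ℝ, 0 < c → ∀ x, sInf (S (c • x)) ≤ c * sInf (S x) := by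
    intro c hc x
    rw [← div_le_iff₀' hc]
    refine le_csInf (hne x) ?_
    rintro _ ⟨z, rfl, rfl⟩
    rw [div_le_iff₀' hc]
    refine csInf_le (hbdd _) ⟨fun i => c • z i, (smul_sum ..).symm, ?_⟩
    simp [(hP _).smul, abs_of_pos hc, mul_sum]
  have hsmul : ∀ c : ℝ, 0 < c → ∀ x, sInf (S (c • x)) = c * sInf (S x) := by
    intro c hc x
    refine le_antisymm (hsmul_le c hc x) ?_
    have h := hsmul_le c⁻¹ (inv_pos.2 hc) (c • x)
    rwa [smul_smul, inv_mul_cancel₀ hc.ne', one_smul, inv_mul_eq_div, le_div_iff₀' hc] at h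
  have hadd : ∀ x y, sInf (S (x + y)) ≤ sInf (S x) + sInf (S y) := by
    intro x y
    rw [← sub_le_iff_le_add]
    refine le_csInf (hne x) ?_
    rintro _ ⟨z, rfl, rfl⟩
    rw [sub_le_comm]
    refine le_csInf (hne y) ?_
    rintro _ ⟨w, rfl, rfl⟩
    rw [sub_le_iff_le_add']
    refine (csInf_le (hbdd _) ⟨fun i => z i + w i, sum_add_distrib, rfl⟩).trans ?_
    rw [← sum_add_distrib]
    exact sum_le_sum fun i _ => (hP i).add_le _ _
  refine ⟨?_, fun b hb => ?_⟩
  · rintro _ ⟨z, rfl, rfl⟩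
    refine (hM.isLUB_dualNorm _).2 ?_
    rintro _ ⟨y, hy, rfl⟩
    simp only [inner_sum]
    refine sum_le_sum fun i _ => ?_
    rw [real_inner_comm]
    exact (hball y).1 hy i (z i)
  · obtain ⟨y, hy, hyx⟩ := exists_inner_le_of_sublinear
      (p := fun x => sInf (S x)) hsmul hadd x
    have hMy : M y ≤ 1 :=
      (hball y).2 fun i z => (hy z).trans (csInf_le (hbdd z) (hsingle i z))
    refine (le_csInf (hne x) hb).trans (hyx.symm.trans_le ?_)
    rw [real_inner_comm]
    exact (hM.isLUB_dualNorm x).1 ⟨y, hMy, rfl⟩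

/-- A weighted sum of norms attains its minimum over the decompositions of `x` with bounded
unweighted sum, as these form a compact set. -/
theorem exists_isLeast_constrained_decomposition [FiniteDimensional ℝ F] {P : ι → F → ℝ}
    (hP : ∀ i, IsNorm (P i)) (w : ι → ℝ) {x : F} {r : ℝ}
    (hne : ∃ z : ι → F, ∑ i, P i (z i) ≤ r ∧ ∑ i, z i = x) :
    ∃ m : ℝ, IsLeast {s : ℝ | ∃ z : ι → F,
      ∑ i, P i (z i) ≤ r ∧ ∑ i, z i = x ∧ s = ∑ i, w i * P i (z i)} m := by
  have hcont : ∀ i, Continuous fun z : ι → F => P i (z i) :=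
    fun i => (hP i).continuous.comp (continuous_apply i)
  choose c hc hcle using fun i => (hP i).exists_mul_norm_le
  have hcompact : IsCompact {z : ι → F | ∑ i, P i (z i) ≤ r ∧ ∑ i, z i = x} := by
    refine (isCompact_univ_pi fun i => isCompact_closedBall (0 : F) (r / c i)).of_isClosed_subset
      ?_ ?_
    · exact (isClosed_le (continuous_finsetSum _ fun i _ => hcont i) continuous_const).inter
        (isClosed_eq (continuous_finsetSum _ fun i _ => continuous_apply i) continuous_const)
    · rintro z ⟨hz, -⟩ i -
      rw [mem_closedBall_zero_iff, le_div_iff₀' (hc i)]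
      exact (hcle i _).trans ((single_le_sum (f := fun i => P i (z i))
        (fun j _ => (hP j).nonneg _) (mem_univ i)).trans hz)
  obtain ⟨z, hz, hmin⟩ := hcompact.exists_isMinOn hne
    (continuous_finsetSum univ fun i _ => (hcont i).const_mul (w i)).continuousOn
  refine ⟨_, ⟨z, hz.1, hz.2, rfl⟩, ?_⟩
  rintro _ ⟨z', h1, h2, rfl⟩
  exact hmin ⟨h1, h2⟩

end Families

/-! ### Coordinate norms -/

section Coordinate

variable {d : ℕ}

theorem IsNorm.restrictionNorm {N : EuclideanSpace ℝ (Fin d) → ℝ} (hN : IsNorm N)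
    (K : Finset (Fin d)) : IsNorm (restrictionNorm N K) where
  nonneg x := hN.nonneg x
  eq_zero_iff x := (hN.eq_zero_iff x).trans Submodule.coe_eq_zero
  smul r x := hN.smul r x
  add_le x y := hN.add_le x y

theorem flatProj_apply (K : Finset (Fin d)) (y : EuclideanSpace ℝ (Fin d)) (j : Fin d) :
    (flatProj K y : EuclideanSpace ℝ (Fin d)) j = if j ∈ K then y j else 0 :=
  rfl

theorem flatProj_add (K : Finset (Fin d)) (x y : EuclideanSpace ℝ (Fin d)) :
    flatProj K (x + y) = flatProj K x + flatProj K y := by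
  ext j
  by_cases hj : j ∈ K <;> simp [flatProj_apply, hj]

theorem flatProj_smul (K : Finset (Fin d)) (r : ℝ) (x : EuclideanSpace ℝ (Fin d)) :
    flatProj K (r • x) = r • flatProj K x := by
  ext j
  by_cases hj : j ∈ K <;> simp [flatProj_apply, hj]

theorem inner_flatProj (K : Finset (Fin d)) (x : flatSubspace K) (y : EuclideanSpace ℝ (Fin d)) :
    inner ℝ x (flatProj K y) = inner ℝ (x : EuclideanSpace ℝ (Fin d)) y := by
  rw [Submodule.coe_inner, PiLp.inner_apply, PiLp.inner_apply]
  refine Finset.sum_congr rfl fun j _ => ?_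
  rw [flatProj_apply]
  split_ifs with hj
  · rfl
  · simp [x.2 j hj]

theorem IsNorm.dualCoordNorm {N : EuclideanSpace ℝ (Fin d) → ℝ} (hN : IsNorm N) {k : ℕ}
    (hk : 1 ≤ k) : IsNorm (dualCoordNorm N k) := by
  have hK := fun K => (hN.restrictionNorm K).isNorm_dualNorm
  have : Nonempty {K : Finset (Fin d) // K.card ≤ k} := ⟨⟨∅, by simp⟩⟩
  refine isNorm_iSup (fun K x => (hK K.1).nonneg _) (fun K r x => ?_) (fun K x y => ?_)
    (fun x hx => ?_)
  · rw [flatProj_smul, (hK K.1).smul]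
  · rw [flatProj_add]
    exact (hK K.1).add_le _ _
  · ext j
    have h := ((hK {j}).eq_zero_iff _).1 (hx ⟨{j}, by simpa using hk⟩)
    have hj := flatProj_apply {j} x j
    rw [h] at hj
    simpa using hj.symm

/-- On vectors with at most `k` nonzero components, the coordinate-`k` norm is at most the source
norm. -/
theorem IsNorm.coordNorm_le {N : EuclideanSpace ℝ (Fin d) → ℝ} (hN : IsNorm N) {k : ℕ}
    (hk : 1 ≤ k) {x : EuclideanSpace ℝ (Fin d)} (hx : (lzero x : ℕ) ≤ k) :
    coordNorm N k x ≤ N x := by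
  refine ((hN.dualCoordNorm hk).dualNorm_le_iff (hN.nonneg x)).2 fun y => ?_
  set K : Finset (Fin d) := Finset.univ.filter fun j => x j ≠ 0
  have hxK : x ∈ flatSubspace K := fun j hj => by simpa [K] using hj
  rw [real_inner_comm]
  calc inner ℝ x y = inner ℝ (⟨x, hxK⟩ : flatSubspace K) (flatProj K y) :=
        (inner_flatProj K ⟨x, hxK⟩ y).symm
    _ ≤ N x * dualNorm (_root_.restrictionNorm N K) (flatProj K y) :=
        (hN.restrictionNorm K).inner_le_mul_dualNorm _ _
    _ ≤ N x * _root_.dualCoordNorm N k y := by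
        refine mul_le_mul_of_nonneg_left ?_ (hN.nonneg x)
        exact le_ciSup (f := fun K : {K : Finset (Fin d) // K.card ≤ k} =>
          dualNorm (_root_.restrictionNorm N K.1) (flatProj K.1 y))
          (Set.finite_range _).bddAbove ⟨K, hx⟩

end Coordinate

/-! ### The norm associated with `φ` -/

theorem mainTheorem4 {d : ℕ} (hd : 1 ≤ d)
    (N : EuclideanSpace ℝ (Fin d) → ℝ) (hN : IsNorm N)
    (φ : Fin (d + 1) → ℝ) (hφ0 : φ 0 = 0) (hφ : ∀ l : Fin d, 0 < φ l.succ) :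
    -- the coordinate norms are the norms whose dual norms are the dual coordinate norms
    (∀ l : Fin d, IsNorm (coordNorm N ((l : ℕ) + 1)) ∧
      dualNorm (coordNorm N ((l : ℕ) + 1)) = dualCoordNorm N ((l : ℕ) + 1)) ∧
    ∃ ν : EuclideanSpace ℝ (Fin d) → ℝ, IsNorm ν ∧
      -- unit ball of the dual norm, and the norm as the support function of that ball
      normUnitBall (dualNorm ν) =
        ⋂ l : Fin d, φ l.succ • normUnitBall (dualCoordNorm N ((l : ℕ) + 1)) ∧
      (∀ x, IsLUB ((fun y => inner ℝ y x) ''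
        ⋂ l : Fin d, φ l.succ • normUnitBall (dualCoordNorm N ((l : ℕ) + 1))) (ν x)) ∧
      -- expression of the dual norm
      (∀ y, dualNorm ν y = ⨆ l : Fin d, dualCoordNorm N ((l : ℕ) + 1) y / φ l.succ) ∧
      -- each of the two descriptions of the dual norm determines the norm
      (∀ μ : EuclideanSpace ℝ (Fin d) → ℝ, IsNorm μ →
        normUnitBall (dualNorm μ) =
          ⋂ l : Fin d, φ l.succ • normUnitBall (dualCoordNorm N ((l : ℕ) + 1)) → μ = ν) ∧
      (∀ μ : EuclideanSpace ℝ (Fin d) → ℝ, IsNorm μ →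
        (∀ y, dualNorm μ y = ⨆ l : Fin d, dualCoordNorm N ((l : ℕ) + 1) y / φ l.succ) → μ = ν) ∧
      -- inf-convolution
      (∀ x, IsGLB {s : ℝ | ∃ z : Fin d → EuclideanSpace ℝ (Fin d),
        ∑ l, z l = x ∧ s = ∑ l : Fin d, φ l.succ * coordNorm N ((l : ℕ) + 1) (z l)} (ν x)) ∧
      -- norm ratio lower bounds, the minimum being attained
      (∀ x, x ≠ 0 → ∃ m : ℝ,
        IsLeast {s : ℝ | ∃ z : Fin d → EuclideanSpace ℝ (Fin d),
          ∑ l : Fin d, coordNorm N ((l : ℕ) + 1) (z l) ≤ N x ∧ ∑ l, z l = x ∧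
          s = ∑ l : Fin d, φ l.succ * coordNorm N ((l : ℕ) + 1) (z l)} m ∧
        ν x / N x ≤ 1 / N x * m ∧
        1 / N x * m ≤ φ (lzero x)) := by
  classical
  have : Nonempty (Fin d) := ⟨⟨0, hd⟩⟩
  have hD : ∀ l : Fin d, IsNorm (dualCoordNorm N ((l : ℕ) + 1)) :=
    fun l => hN.dualCoordNorm (Nat.le_add_left 1 l)
  have hC : ∀ l : Fin d, IsNorm (coordNorm N ((l : ℕ) + 1)) := fun l => (hD l).isNorm_dualNorm
  have hCD : ∀ l : Fin d, dualNorm (coordNorm N ((l : ℕ) + 1)) = dualCoordNorm N ((l : ℕ) + 1) :=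
    fun l => (hD l).dualNorm_dualNorm
  set M : EuclideanSpace ℝ (Fin d) → ℝ :=
    fun y => ⨆ l : Fin d, dualCoordNorm N ((l : ℕ) + 1) y / φ l.succ with hMdef
  have hM : IsNorm M := by
    refine isNorm_iSup (fun l y => div_nonneg ((hD l).nonneg y) (hφ l).le)
      (fun l r y => ?_) (fun l x y => ?_) (fun y hy => ?_)
    · rw [(hD l).smul, mul_div_assoc]
    · rw [← add_div]
      exact div_le_div_of_nonneg_right ((hD l).add_le x y) (hφ l).le
    · have h := hy ⟨0, hd⟩
      rw [div_eq_zero_iff, or_iff_left (hφ _).ne'] at h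
      exact ((hD _).eq_zero_iff y).1 h
  have hM_le : ∀ y, M y ≤ 1 ↔ ∀ l : Fin d, dualCoordNorm N ((l : ℕ) + 1) y ≤ φ l.succ := by
    intro y
    simp only [hMdef]
    rw [ciSup_le_iff (Set.finite_range _).bddAbove]
    simp only [div_le_one (hφ _)]
  have hball : normUnitBall M =
      ⋂ l : Fin d, φ l.succ • normUnitBall (dualCoordNorm N ((l : ℕ) + 1)) := by
    ext y
    simp only [Set.mem_iInter, (hD _).smul_normUnitBall (hφ _)]
    exact hM_le y
  have hMM : dualNorm (dualNorm M) = M := hM.dualNorm_dualNorm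
  have hP : ∀ l : Fin d, IsNorm fun z => φ l.succ * coordNorm N ((l : ℕ) + 1) z := fun l =>
    { nonneg := fun z => mul_nonneg (hφ l).le ((hC l).nonneg z)
      eq_zero_iff := fun z => by
        rw [mul_eq_zero, or_iff_right (hφ l).ne', (hC l).eq_zero_iff]
      smul := fun r z => by rw [(hC l).smul]; ring
      add_le := fun y z => by
        rw [← mul_add]
        exact mul_le_mul_of_nonneg_left ((hC l).add_le y z) (hφ l).le }
  have hconv := isGLB_infConvolution_dualNorm hP hM fun y => by
    rw [hM_le]
    refine forall_congr' fun l => ?_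
    rw [← hCD l, (hC l).dualNorm_le_iff (hφ l).le]
  refine ⟨fun l => ⟨hC l, hCD l⟩, dualNorm M, hM.isNorm_dualNorm, ?_, ?_, ?_, ?_, ?_, hconv, ?_⟩
  · rw [hMM, hball]
  · intro x
    rw [← hball]
    exact hM.isLUB_dualNorm x
  · exact fun y => congrFun hMM y
  · intro μ hμ h
    refine hμ.eq_of_normUnitBall_dualNorm_eq hM.isNorm_dualNorm ?_
    rw [h, hMM, hball]
  · intro μ hμ h
    rw [← hμ.dualNorm_dualNorm, show dualNorm μ = M from funext h]
  · intro x hx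
    have hNx := hN.pos hx
    have hlx : lzero x ≠ 0 := by
      intro h
      apply hx
      ext j
      have h0 : (Finset.univ.filter fun j => x j ≠ 0).card = 0 := congrArg Fin.val h
      by_contra hj
      rw [Finset.card_eq_zero] at h0
      exact Finset.notMem_empty j (h0 ▸ Finset.mem_filter.2 ⟨Finset.mem_univ j, hj⟩)
    obtain ⟨l, hl⟩ := Fin.exists_succ_eq.2 hlx
    have hCx : coordNorm N ((l : ℕ) + 1) x ≤ N x :=
      hN.coordNorm_le (Nat.le_add_left 1 l) (by simp [← hl])
    -- `Pi.single l x` is the admissible decomposition that bounds the minimum; the index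
    -- `l : Fin d` is shifted by one, `l + 1 = ℓ₀ x`
    have hsum : ∀ w : Fin d → ℝ, ∑ i : Fin d, w i * coordNorm N ((i : ℕ) + 1)
        ((Pi.single l x : Fin d → EuclideanSpace ℝ (Fin d)) i) =
          w l * coordNorm N ((l : ℕ) + 1) x := by
      intro w
      rw [Finset.sum_eq_single l (fun j _ hj => by simp [hj, (hC j).map_zero]) (by simp)]
      simp
    have hfeas : ∑ i : Fin d, coordNorm N ((i : ℕ) + 1)
        ((Pi.single l x : Fin d → EuclideanSpace ℝ (Fin d)) i) ≤ N x := by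
      have h := hsum fun _ => 1
      simp only [one_mul] at h
      exact h.trans_le hCx
    obtain ⟨m, hm⟩ := exists_isLeast_constrained_decomposition hC (fun l => φ l.succ)
      (x := x) (r := N x) ⟨Pi.single l x, hfeas, by simp⟩
    refine ⟨m, hm, ?_, ?_⟩
    · rw [one_div, inv_mul_eq_div]
      obtain ⟨z, -, hz, hmz⟩ := hm.1
      exact div_le_div_of_nonneg_right ((hconv x).1 ⟨z, hz, hmz⟩) hNx.le
    · rw [one_div, inv_mul_eq_div, div_le_iff₀ hNx, ← hl]
      refine (hm.2 ⟨Pi.single l x, hfeas, by simp, rfl⟩).trans ?_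
      rw [hsum fun i => φ i.succ]
      exact mul_le_mul_of_nonneg_left hCx (hφ l).le
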